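/- Let $k$ be an algebraically closed field of characteristic zero, $A$ a finitely generated associative unital $k$-algebra, $A^e=A\otimes_k A^{\mathrm{op}}$, and $n\ge 0$. Assume that $A$ is $2$-Calabi--Yau: $A$ has a finite resolution by finitely generated projective left $A^e$-modules, $\mathrm{Ext}^i_{A^e}(A,A^e)=0$ for $i\neq 2$, and $\mathrm{Ext}^2_{A^e}(A,A^e)\cong A$ as $A$-bimodules (the bimodule structure on $\mathrm{Ext}$ being induced by the right multiplications of $A^e$ on itself). Let $\mathrm{Rep}^n_A=\mathrm{Spec}\,V_n(A)$ be the scheme of $n$-dimensional representations of $A$, where $V_n(A)$ is the commutative $k$-algebra representing $B\mapsto \mathrm{Hom}_{k\text{-alg}}(A,\mathrm{Mat}_n(B))$, and give the set of its $k$-points $\mathrm{Rep}^n_A(k)=\mathrm{Hom}_{k\text{-alg}}(A,\mathrm{Mat}_n(k))$ the Zariski topology. For a point $M\in\mathrm{Rep}^n_A(k)$, also write $M$ for the corresponding $A$-module $k^n$, regard $\mathrm{End}_k(M)$ as an $A^e$-module by $(a\otimes b)f=a\circ f\circ b$, and let $T_M\mathrm{Rep}^n_A=(\mathfrak m_M/\mathfrak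 m_M^2)^*$ be the Zariski tangent space of the scheme $\mathrm{Rep}^n_A$ at $M$. Let $F_\bullet\to A$ be a resolution of $A$ by finitely generated projective left $A^e$-modules such that the functions $$c^i:\mathrm{Rep}^n_A(k)\to\mathbb N,\qquad M\mapsto \dim_k\mathrm{Hom}_{A^e}(F_i,\mathrm{End}_k(M))$$ are locally constant for $i=0,1,2$. Then there is a locally constant function $N:\mathrm{Rep}^n_A(k)\to\mathbb Z$ such that $$\dim_k T_M\mathrm{Rep}^n_A=N(M)+\dim_k\mathrm{End}_A(M)\qquad\text{for all } M\in\mathrm{Rep}^n_A(k).$$ In particular, for every irreducible component $Z$ of $\mathrm{Rep}^n_A(k)$ there is a strictly increasing function $f:\mathbb N\to\mathbb Z$ such that $\dim_k T_M\mathrm{Rep}^n_A=f(\dim_k\mathrm{End}_A(M))$ for all $M\in Z$. -/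

import Mathlib

open TensorProduct CategoryTheory

universe u

noncomputable section

namespace CYRep

/-! ### Enveloping algebra and Calabi-Yau algebras -/

section CalabiYau

variable (k A : Type u) [Field k] [Ring A] [Algebra k A]

/-- The enveloping algebra `Aᵉ = A ⊗ Aᵒᵖ`; left `Aᵉ`-modules are `A`-bimodules. -/
abbrev Env : Type u := A ⊗[k] Aᵐᵒᵖ

/-- `A` as a left `Aᵉ`-module: `(a ⊗ op b) • x = a * x * b`. -/
def diagBimod : ModuleCat.{u} (Env k A) :=
  letI : Module (Env k A) A := instModuleTensorProductMop k A
  ModuleCat.of (Env k A) A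

lemma diagBimod_smul (a b x : A) :
    (((a ⊗ₜ[k] MulOpposite.op b : Env k A) • (show diagBimod k A from x) : diagBimod k A) : A) =
      a * x * b :=
  AlgHom.mulLeftRight_apply k A a (MulOpposite.op b) x

/-- `Aᵉ` as a left module over itself (the outer bimodule structure of `A ⊗ A`). -/
abbrev envBimod : ModuleCat.{u} (Env k A) := ModuleCat.of (Env k A) (Env k A)

/-- Right multiplication `x ↦ x * s` on `Aᵉ`, a morphism of left `Aᵉ`-modules. -/
def envRightMul (s : Env k A) : envBimod k A ⟶ envBimod k A :=
  ModuleCat.ofHom (LinearMap.toSpanSingleton (Env k A) (Env k A) s)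

/-- `A` is homologically smooth: as an `Aᵉ`-module it has a finite resolution by finitely
generated projective `Aᵉ`-modules. -/
def HomologicallySmooth : Prop :=
  ∃ P : ProjectiveResolution (diagBimod k A),
    (∀ i, Module.Finite (Env k A) (P.complex.X i)) ∧
    ∃ m : ℕ, ∀ i, m < i → Limits.IsZero (P.complex.X i)

/-- `A` is `d`-Calabi-Yau: it is homologically smooth, `Extⁱ(A, Aᵉ) = 0` over `Aᵉ` for `i ≠ d`, and
`Extᵈ(A, Aᵉ) ≅ A` as `A`-bimodules. The bimodule structure of `Extᵈ(A, Aᵉ)` is the one induced by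
the right multiplications of `Aᵉ` on the second argument (the inner bimodule structure of `A ⊗ A`):
`b ξ a` is the image of `ξ` under right multiplication by `a ⊗ op b`, i.e. under
`x ⊗ op y ↦ x a ⊗ op (b y)`. -/
structure IsCalabiYau (d : ℕ) : Prop where
  smooth : HomologicallySmooth k A
  ext_eq_zero : ∀ i : ℕ, i ≠ d → Subsingleton (Abelian.Ext (diagBimod k A) (envBimod k A) i)
  ext_iso : ∃ e : Abelian.Ext (diagBimod k A) (envBimod k A) d ≃+ A,
    ∀ (a b : A) (ξ : Abelian.Ext (diagBimod k A) (envBimod k A) d),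
      e (ξ.comp (Abelian.Ext.mk₀ (envRightMul k A (a ⊗ₜ[k] MulOpposite.op b))) (add_zero d)) =
        b * e ξ * a

end CalabiYau

/-! ### The scheme of `n`-dimensional representations -/

section RepScheme

variable (k A : Type u) [Field k] [Ring A] [Algebra k A] (n : ℕ)

/-- The matrix of indeterminates `(x_{a,i,j})_{i,j}` attached to `a : A`. -/
def genMat (a : A) : Matrix (Fin n) (Fin n) (MvPolynomial (A × Fin n × Fin n) k) :=
  Matrix.of fun i j => MvPolynomial.X (a, i, j)

/-- The relations saying that `a ↦ (x_{a,i,j})_{i,j}` is a homomorphism of `k`-algebras. -/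
def repIdeal : Ideal (MvPolynomial (A × Fin n × Fin n) k) :=
  Ideal.span
    ({p | ∃ (a b : A) (i j : Fin n),
        p = (genMat k A n (a + b) - (genMat k A n a + genMat k A n b)) i j} ∪
     {p | ∃ (a b : A) (i j : Fin n),
        p = (genMat k A n (a * b) - genMat k A n a * genMat k A n b) i j} ∪
     {p | ∃ (c : k) (i j : Fin n),
        p = genMat k A n (algebraMap k A c) i j - if i = j then MvPolynomial.C c else 0})

/-- The coordinate ring `V_n(A)` of the scheme `Rep_A^n = Spec V_n(A)`. -/
abbrev RepRing : Type u := MvPolynomial (A × Fin n × Fin n) k ⧸ repIdeal k A n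

variable {k A n}

lemma repIdeal_le_ker {B : Type*} [CommRing B] [Algebra k B]
    (ρ : A →ₐ[k] Matrix (Fin n) (Fin n) B) :
    repIdeal k A n ≤ RingHom.ker
      (MvPolynomial.aeval (R := k) fun x : A × Fin n × Fin n => ρ x.1 x.2.1 x.2.2) := by
  refine Ideal.span_le.2 ?_
  rintro p ((⟨a, b, i, j, rfl⟩ | ⟨a, b, i, j, rfl⟩) | ⟨c, i, j, rfl⟩)
  · simp [genMat]
  · simp [genMat, Matrix.mul_apply]
  · by_cases h : i = j <;> simp [genMat, Matrix.algebraMap_matrix_apply, h]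

/-- The homomorphism `V_n(A) → B` classifying a representation of `A` over `B`. -/
def classify {B : Type*} [CommRing B] [Algebra k B]
    (ρ : A →ₐ[k] Matrix (Fin n) (Fin n) B) : RepRing k A n →ₐ[k] B :=
  Ideal.Quotient.liftₐ (repIdeal k A n)
    (MvPolynomial.aeval fun x : A × Fin n × Fin n => ρ x.1 x.2.1 x.2.2)
    fun _ hp => repIdeal_le_ker ρ hp

lemma classify_mk_X {B : Type*} [CommRing B] [Algebra k B]
    (ρ : A →ₐ[k] Matrix (Fin n) (Fin n) B) (x : A × Fin n × Fin n) :
    classify ρ (Ideal.Quotient.mk (repIdeal k A n) (MvPolynomial.X x)) = ρ x.1 x.2.1 x.2.2 := by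
  change MvPolynomial.aeval (R := k) (fun x : A × Fin n × Fin n => ρ x.1 x.2.1 x.2.2)
    (MvPolynomial.X x) = _
  simp

variable (k A n) in
/-- The matrix of the classes of the indeterminates attached to `a`. -/
def univMat (a : A) : Matrix (Fin n) (Fin n) (RepRing k A n) :=
  (genMat k A n a).map (Ideal.Quotient.mkₐ k (repIdeal k A n))

lemma univMat_add (a b : A) : univMat k A n (a + b) = univMat k A n a + univMat k A n b := by
  ext i j
  have h : (genMat k A n (a + b) - (genMat k A n a + genMat k A n b)) i j ∈ repIdeal k A n :=
    Ideal.subset_span (Or.inl (Or.inl ⟨a, b, i, j, rfl⟩))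
  have h' := (Ideal.Quotient.eq (I := repIdeal k A n)).2 h
  simpa [univMat] using h'

lemma univMat_mul (a b : A) : univMat k A n (a * b) = univMat k A n a * univMat k A n b := by
  ext i j
  have h : (genMat k A n (a * b) - genMat k A n a * genMat k A n b) i j ∈ repIdeal k A n :=
    Ideal.subset_span (Or.inl (Or.inr ⟨a, b, i, j, rfl⟩))
  have h' := (Ideal.Quotient.eq (I := repIdeal k A n)).2 h
  simpa [univMat, Matrix.mul_apply] using h'

lemma univMat_algebraMap (c : k) :
    univMat k A n (algebraMap k A c) = algebraMap k (Matrix (Fin n) (Fin n) (RepRing k A n)) c := by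
  ext i j
  have h : genMat k A n (algebraMap k A c) i j - (if i = j then MvPolynomial.C c else 0) ∈ repIdeal k A n :=
    Ideal.subset_span (Or.inr ⟨c, i, j, rfl⟩)
  have h' := (Ideal.Quotient.eq (I := repIdeal k A n)).2 h
  by_cases hij : i = j
  · subst hij
    simp only [univMat, Matrix.algebraMap_matrix_apply, Matrix.map_apply, if_true] at h' ⊢
    exact h'
  · simpa [univMat, Matrix.algebraMap_matrix_apply, hij] using h'

variable (k A n) in
/-- The universal `n`-dimensional representation `A → Mat_n(V_n(A))`. -/
def univRep : A →ₐ[k] Matrix (Fin n) (Fin n) (RepRing k A n) where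
  toFun := univMat k A n
  map_one' := by simpa using univMat_algebraMap (k := k) (A := A) (n := n) 1
  map_zero' := by simpa using univMat_algebraMap (k := k) (A := A) (n := n) 0
  map_add' := univMat_add
  map_mul' := univMat_mul
  commutes' := univMat_algebraMap

variable (k A n) in
/-- `V_n(A)` represents the functor `B ↦ Hom_{k-alg}(A, Mat_n(B))`. -/
def repEquiv (B : Type*) [CommRing B] [Algebra k B] :
    (RepRing k A n →ₐ[k] B) ≃ (A →ₐ[k] Matrix (Fin n) (Fin n) B) where
  toFun f := f.mapMatrix.comp (univRep k A n)
  invFun := classify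
  left_inv f := by
    refine Ideal.Quotient.algHom_ext k ?_
    refine MvPolynomial.algHom_ext fun x => ?_
    simp [classify_mk_X, univRep, univMat, genMat]
  right_inv ρ := by
    ext a i j
    simp [classify_mk_X, univRep, univMat, genMat]

variable (k A n) in
/-- The set `Rep_A^n(k)` of `n`-dimensional representations of `A` over `k`. -/
def RepPt : Type u := A →ₐ[k] Matrix (Fin n) (Fin n) k

namespace RepPt

variable (M : RepPt k A n)

/-- The maximal ideal of `V_n(A)` at the `k`-point `M`. -/
def maxIdeal : Ideal (RepRing k A n) := RingHom.ker (classify (A := A) (n := n) (B := k) M)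

instance : M.maxIdeal.IsPrime := RingHom.ker_isPrime _

/-- The `k`-point `M` as a point of `Spec V_n(A)`. -/
def toSpec : PrimeSpectrum (RepRing k A n) := ⟨M.maxIdeal, inferInstance⟩

/-- The Zariski topology on `Rep_A^n(k)`. -/
instance : TopologicalSpace (RepPt k A n) := TopologicalSpace.induced toSpec inferInstance

/-- The Zariski tangent space `T_M Rep_A^n = (𝔪 / 𝔪²)*`. -/
abbrev TangentSpace : Type u := Module.Dual k M.maxIdeal.Cotangent

/-- The `A`-module `kⁿ` given by the representation `M`. -/
def Mod (_ : RepPt k A n) : Type u := Fin n → k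

instance : AddCommGroup M.Mod := inferInstanceAs (AddCommGroup (Fin n → k))

instance : Module k M.Mod := inferInstanceAs (Module k (Fin n → k))

/-- The representation as a homomorphism `A → End_k(kⁿ)`. -/
def toEnd : A →ₐ[k] Module.End k M.Mod :=
  AlgHom.comp (Matrix.toLinAlgEquiv' (R := k) (n := Fin n)).toAlgHom M

instance : Module A M.Mod := Module.compHom M.Mod M.toEnd.toRingHom

lemma smul_def (a : A) (v : M.Mod) : a • v = M.toEnd a v := rfl

instance : SMulCommClass A k M.Mod where
  smul_comm a c v := by simp [smul_def]

/-- The action of `Aᵉ` on `End_k(M)`: `(a ⊗ op b) f = a ∘ f ∘ b`. -/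
def envAct : Env k A →ₐ[k] Module.End k (Module.End k M.Mod) :=
  (AlgHom.mulLeftRight k (Module.End k M.Mod)).comp
    (Algebra.TensorProduct.map M.toEnd (AlgHom.op M.toEnd))

instance : Module (Env k A) (Module.End k M.Mod) :=
  Module.compHom (Module.End k M.Mod) M.envAct.toRingHom

lemma env_smul_def (s : Env k A) (f : Module.End k M.Mod) : s • f = M.envAct s f := rfl

lemma tmul_smul_apply (a b : A) (f : Module.End k M.Mod) (v : M.Mod) :
    ((a ⊗ₜ[k] MulOpposite.op b : Env k A) • f) v = a • f (b • v) := by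
  simp [env_smul_def, smul_def, envAct]

instance : SMulCommClass (Env k A) k (Module.End k M.Mod) where
  smul_comm s c f := by simp [env_smul_def]

end RepPt

end RepScheme

end CYRep

end

/-! Write `E` for the bimodule `End_k(M)` and `Ω` for the kernel of the multiplication map `Aᵉ → A`.
Tangent vectors at `M` are dual-number deformations of `M`, that is, derivations `A → E`, and these
are the bimodule maps `Ω → E` (`derOfTangent_bijective`, `derOfHom_bijective`). So the task is to
compute `dim Hom(Ω, E)`.

Smoothness and the vanishing of `Extⁱ(A, Aᵉ)` for `i > 2` allow a finite resolution to be cut down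
to `0 → P → Q → X₂ → A → 0` with finitely generated projective terms
(`HasFGProjectiveResolution.shorten`). Schanuel's lemma compares `Ω` with the kernel of `X₂ → A`,
and left exactness of `Hom(-, E)` reduces that kernel to `Q` and the rank of `Hom(Q, E) → Hom(P,
E)`.

The cokernel of this last map is where the Calabi-Yau condition enters. Over `Aᵉ` the corresponding
cokernel is `Ext²(A, Aᵉ) ≅ A`; tensoring with `E` gives `A ⊗ E` over `Aᵉ`, whose dual is `End_A(M)`
through the trace form (`RepPt.finrank_range_add_finrank_end`).

What remains is an alternating sum of dimensions of `Hom(-, E)` on projectives. Each is the trace of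
an idempotent, hence a bounded integer-valued regular function, hence locally constant in
characteristic zero (`isLocallyConstant_finrank_hom`). -/

noncomputable section

namespace CYRep

/-! ### Finite projective resolutions and Ext -/

section Resolutions

variable {R : Type u} [Ring R]

/-- A finitely generated projective module has a finite dual basis. -/
lemma exists_finite_dualBasis (P : Type*) [AddCommGroup P] [Module R P]
    [Module.Finite R P] [Module.Projective R P] :
    ∃ (r : ℕ) (x : Fin r → P) (φ : Fin r → P →ₗ[R] R), ∀ p, ∑ i, φ i p • x i = p := by
  obtain ⟨r, f, g, -, -, hfg⟩ := Module.Finite.exists_comp_eq_id_of_projective R P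
  refine ⟨r, fun i => f (Pi.single i 1), fun i => LinearMap.proj i ∘ₗ g, fun p => ?_⟩
  conv_rhs => rw [← LinearMap.id_apply (R := R) p, ← hfg, LinearMap.comp_apply,
    ← Finset.univ_sum_single (g p), map_sum]
  refine Finset.sum_congr rfl fun i _ => ?_
  rw [LinearMap.comp_apply, LinearMap.proj_apply, ← map_smul, ← Pi.single_smul, smul_eq_mul, mul_one]

/-- `X` has a resolution of length at most `d` by finitely generated projective modules. -/
def HasFGProjectiveResolution : ℕ → ModuleCat.{u} R → Prop
  | 0, X => Module.Finite R X ∧ Module.Projective R X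
  | d + 1, X => ∃ S : ShortComplex (ModuleCat.{u} R), S.ShortExact ∧ S.X₃ = X ∧
      Module.Finite R S.X₂ ∧ Module.Projective R S.X₂ ∧ HasFGProjectiveResolution d S.X₁

/-- If `P` is finitely generated projective and every functional on `P` extends along `i : P → Q`,
then `i` has a retraction. -/
lemma exists_retraction_of_extends {P Q : Type*} [AddCommGroup P] [Module R P] [AddCommGroup Q]
    [Module R Q] [Module.Finite R P] [Module.Projective R P] (i : P →ₗ[R] Q)
    (h : ∀ φ : P →ₗ[R] R, ∃ ψ : Q →ₗ[R] R, ψ ∘ₗ i = φ) :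
    ∃ ρ : Q →ₗ[R] P, ρ ∘ₗ i = LinearMap.id := by
  obtain ⟨r, x, φ, hx⟩ := exists_finite_dualBasis (R := R) P
  choose ψ hψ using h
  refine ⟨∑ j, (ψ (φ j)).smulRight (x j), ?_⟩
  ext p
  have : ∀ j, ψ (φ j) (i p) = φ j p := fun j => LinearMap.congr_fun (hψ (φ j)) p
  simp [this, hx]

/-- In a short exact sequence with projective middle term, `Extᵈ⁺¹(X₁, Y)` vanishes as soon as
`Extᵈ⁺²(X₃, Y)` does. -/
lemma subsingleton_ext_of_shortExact {S : ShortComplex (ModuleCat.{u} R)} (hS : S.ShortExact)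
    [Projective S.X₂] (Y : ModuleCat.{u} R) (d : ℕ)
    [Subsingleton (Abelian.Ext S.X₃ Y (d + 2))] : Subsingleton (Abelian.Ext S.X₁ Y (d + 1)) := by
  refine subsingleton_of_forall_eq 0 fun x => ?_
  obtain ⟨y, rfl⟩ := Abelian.Ext.contravariant_sequence_exact₁ hS Y x
    (show 1 + (d + 1) = d + 2 by lia) (Subsingleton.elim _ _)
  rw [Abelian.Ext.eq_zero_of_projective y, Abelian.Ext.comp_zero]

/-- If `Ext¹(X₃, Y) = 0`, every map `X₁ → Y` extends to `X₂`. -/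
lemma exists_extension_of_subsingleton_ext {S : ShortComplex (ModuleCat.{u} R)}
    (hS : S.ShortExact) (Y : ModuleCat.{u} R) [Subsingleton (Abelian.Ext S.X₃ Y 1)]
    (φ : S.X₁ ⟶ Y) : ∃ ψ : S.X₂ ⟶ Y, S.f ≫ ψ = φ := by
  obtain ⟨y, hy⟩ := Abelian.Ext.contravariant_sequence_exact₁ hS Y (Abelian.Ext.mk₀ φ)
    (show 1 + 0 = 1 from rfl) (Subsingleton.elim _ _)
  obtain ⟨ψ, rfl⟩ := (Abelian.Ext.mk₀_bijective _ _).2 y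
  exact ⟨ψ, (Abelian.Ext.mk₀_bijective _ _).1 (by rw [← hy, Abelian.Ext.mk₀_comp_mk₀])⟩

/-- A resolution by finitely generated projective modules can be shortened when the top Ext with
values in the ring vanishes. -/
lemma HasFGProjectiveResolution.shorten (d : ℕ) : ∀ (X : ModuleCat.{u} R),
    HasFGProjectiveResolution (d + 1) X →
    Subsingleton (Abelian.Ext X (ModuleCat.of R R) (d + 1)) → HasFGProjectiveResolution d X := by
  induction d with
  | zero =>
    rintro _ ⟨S, hS, rfl, hfin, hproj, hfin₁, hproj₁⟩ hE
    -- Vanishing of `Ext¹` extends functionals from the kernel to the middle term, so the sequence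
    -- splits and the quotient is itself projective.
    obtain ⟨ρ, hρ⟩ := exists_retraction_of_extends S.f.hom fun φ => by
      obtain ⟨ψ, hψ⟩ := exists_extension_of_subsingleton_ext hS _ (ModuleCat.ofHom φ)
      exact ⟨ψ.hom, by rw [← ModuleCat.hom_comp, hψ, ModuleCat.hom_ofHom]⟩
    have hex := (ShortComplex.ShortExact.moduleCat_exact_iff_function_exact S).1 hS.exact
    have hsurj : Function.Surjective S.g.hom := hS.moduleCat_surjective_g
    obtain ⟨σ, hσ⟩ : ∃ σ, S.g.hom ∘ₗ σ = LinearMap.id :=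
      ((hex.split_tfae'.out 0 1 rfl rfl).2 ⟨hsurj, ρ, hρ⟩).2
    exact ⟨Module.Finite.of_surjective S.g.hom hsurj, Module.Projective.of_split σ S.g.hom hσ⟩
  | succ d ih =>
    rintro _ ⟨S, hS, rfl, hfin, hproj, hK⟩ hE
    have : Projective S.X₂ := (IsProjective.iff_projective _).1 hproj
    exact ⟨S, hS, rfl, hfin, hproj, ih _ hK (subsingleton_ext_of_shortExact hS _ d)⟩

/-- Iterates `shorten`, removing the top term until the length reaches `d`, the last degree where
`Ext` into the ring may survive. -/
lemma HasFGProjectiveResolution.of_shorten {d : ℕ} {X : ModuleCat.{u} R}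
    (hE : ∀ i, d < i → Subsingleton (Abelian.Ext X (ModuleCat.of R R) i)) (m : ℕ)
    (h : HasFGProjectiveResolution (d + m) X) : HasFGProjectiveResolution d X := by
  induction m with
  | zero => exact h
  | succ m ih => exact ih (h.shorten _ X (hE _ (by lia)))

/-- The boundaries of a finite resolution by finitely generated projective modules. -/
lemma hasFGProjectiveResolution_range_d {X : ModuleCat.{u} R} (P : ProjectiveResolution X)
    (hfin : ∀ i, Module.Finite R (P.complex.X i)) (m : ℕ)
    (hm : ∀ i, m < i → Limits.IsZero (P.complex.X i)) (j i : ℕ) (hij : m ≤ i + j) :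
    HasFGProjectiveResolution j
      (ModuleCat.of R (LinearMap.range (P.complex.d (i + 1) i).hom)) := by
  induction j generalizing i with
  | zero =>
    -- Here `m ≤ i`, so the term in degree `i + 1` is already past the end of the resolution.
    have : Subsingleton (P.complex.X (i + 1)) :=
      ModuleCat.subsingleton_of_isZero (hm _ (by lia))
    have : Subsingleton (LinearMap.range (P.complex.d (i + 1) i).hom) :=
      (LinearMap.surjective_rangeRestrict (P.complex.d (i + 1) i).hom).subsingleton
    exact ⟨inferInstanceAs (Module.Finite R (LinearMap.range (P.complex.d (i + 1) i).hom)),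
      inferInstanceAs (Module.Projective R (LinearMap.range (P.complex.d (i + 1) i).hom))⟩
  | succ j ih =>
    have hex : LinearMap.range (P.complex.d (i + 2) (i + 1)).hom =
        LinearMap.ker (P.complex.d (i + 1) i).hom := (P.exact_succ i).moduleCat_range_eq_ker
    refine ⟨ShortComplex.mk
      (ModuleCat.ofHom (LinearMap.range (P.complex.d (i + 2) (i + 1)).hom).subtype)
      (ModuleCat.ofHom (P.complex.d (i + 1) i).hom.rangeRestrict) ?_, ?_, rfl, hfin _,
      (IsProjective.iff_projective _).2 (P.projective _), ih (i + 1) (by lia)⟩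
    · ext x
      have := hex.le x.2
      exact this
    · refine ModuleCat.shortComplex_shortExact _ ?_ (Submodule.injective_subtype _)
        (LinearMap.surjective_rangeRestrict _)
      rw [LinearMap.exact_iff]
      simp [hex]

lemma hasFGProjectiveResolution_of_projectiveResolution {X : ModuleCat.{u} R}
    (P : ProjectiveResolution X) (hfin : ∀ i, Module.Finite R (P.complex.X i)) (m : ℕ)
    (hm : ∀ i, m < i → Limits.IsZero (P.complex.X i)) :
    HasFGProjectiveResolution (m + 1) X := by
  have hex : LinearMap.range (P.complex.d 1 0).hom = LinearMap.ker (P.π.f 0).hom :=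
    (ShortComplex.exact_of_g_is_cokernel (ShortComplex.mk _ _ P.complex_d_comp_π_f_zero)
      P.isColimitCokernelCofork).moduleCat_range_eq_ker
  refine ⟨ShortComplex.mk (ModuleCat.ofHom (LinearMap.range (P.complex.d 1 0).hom).subtype)
    (P.π.f 0) ?_, ?_, rfl, hfin _, (IsProjective.iff_projective _).2 (P.projective _),
    hasFGProjectiveResolution_range_d P hfin m hm m 0 (by lia)⟩
  · ext x
    exact hex.le x.2
  · refine ModuleCat.shortComplex_shortExact _ ?_ (Submodule.injective_subtype _)
      ((ModuleCat.epi_iff_surjective _).1 inferInstance)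
    rw [LinearMap.exact_iff]
    simp [hex]

/-- Schanuel's lemma. -/
lemma exists_schanuel_equiv {P Q X : Type*} [AddCommGroup P] [AddCommGroup Q] [AddCommGroup X]
    [Module R P] [Module R Q] [Module R X] [Module.Projective R P] [Module.Projective R Q]
    (p : P →ₗ[R] X) (q : Q →ₗ[R] X) (hp : Function.Surjective p) (hq : Function.Surjective q) :
    Nonempty ((LinearMap.ker p × Q) ≃ₗ[R] (LinearMap.ker q × P)) := by
  obtain ⟨s, hs⟩ := Module.projective_lifting_property p q hp
  obtain ⟨t, ht⟩ := Module.projective_lifting_property q p hq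
  have hs' : ∀ y, p (s y) = q y := LinearMap.congr_fun hs
  have ht' : ∀ y, q (t y) = p y := LinearMap.congr_fun ht
  -- Both sides parametrise the fibre product of `p` and `q`: a pair `(u, y)` stands for the point
  -- `(u + s y, y)`, whose second coordinate is then corrected by `t` to lie in `ker q`.
  exact ⟨{
    toFun := fun z => (⟨z.2 - t (z.1 + s z.2), by simp [hs', ht']⟩, z.1 + s z.2)
    invFun := fun z => (⟨z.2 - s (z.1 + t z.2), by simp [hs', ht']⟩, z.1 + t z.2)
    map_add' := fun a b => by
      ext <;> simp <;> abel
    map_smul' := fun c a => by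
      ext <;> simp [smul_sub]
    left_inv := fun z => by ext <;> simp
    right_inv := fun z => by ext <;> simp }⟩

/-- The Ext group in degree two computed by a projective resolution of length two. -/
lemma exists_ext_two_presentation {S T : ShortComplex (ModuleCat.{u} R)} (hS : S.ShortExact)
    (hT : T.ShortExact) (h : S.X₁ = T.X₃) [Projective S.X₂] [Projective T.X₂]
    (Y : ModuleCat.{u} R) :
    ∃ Θ : (T.X₁ ⟶ Y) →+ Abelian.Ext S.X₃ Y 2, Function.Surjective Θ ∧
      (∀ φ, Θ φ = 0 ↔ ∃ ψ : T.X₂ ⟶ Y, T.f ≫ ψ = φ) ∧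
      ∀ (φ : T.X₁ ⟶ Y) (g : Y ⟶ Y),
        Θ (φ ≫ g) = (Θ φ).comp (Abelian.Ext.mk₀ g) (add_zero 2) := by
  -- `c` is the extension class of `S`, transported along `h`. Multiplication by it is injective and
  -- surjective from `Ext¹` to `Ext²` because `S.X₂` is projective.
  obtain ⟨c, hc₁, hc₃⟩ : ∃ c : Abelian.Ext S.X₃ T.X₃ 1,
      (∀ x : Abelian.Ext T.X₃ Y 1, c.comp x (show 1 + 1 = 2 from rfl) = 0 → x = 0) ∧
      ∀ z : Abelian.Ext S.X₃ Y 2, ∃ x : Abelian.Ext T.X₃ Y 1, c.comp x rfl = z := by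
    rw [← h]
    refine ⟨hS.extClass, fun x hx => ?_, fun z => ?_⟩
    · obtain ⟨y, rfl⟩ := Abelian.Ext.contravariant_sequence_exact₁ hS Y x rfl hx
      rw [Abelian.Ext.eq_zero_of_projective y, Abelian.Ext.comp_zero]
    · exact Abelian.Ext.contravariant_sequence_exact₃ hS Y z (Abelian.Ext.eq_zero_of_projective _) rfl
  -- `Θ φ` is the Yoneda product of the two extension classes with `φ`; compatibility with `g` is
  -- then associativity.
  refine ⟨AddMonoidHom.mk' (fun φ => c.comp (hT.extClass.comp (Abelian.Ext.mk₀ φ) (add_zero 1)) rfl)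
    fun a b => by simp only [Abelian.Ext.mk₀_add, Abelian.Ext.comp_add], fun z => ?_, fun φ => ?_,
    fun φ g => ?_⟩
  · obtain ⟨x, rfl⟩ := hc₃ z
    obtain ⟨y, rfl⟩ := Abelian.Ext.contravariant_sequence_exact₃ hT Y x
      (Abelian.Ext.eq_zero_of_projective _) (add_zero 1)
    obtain ⟨φ, rfl⟩ := (Abelian.Ext.mk₀_bijective _ _).2 y
    exact ⟨φ, rfl⟩
  · constructor
    · intro h0
      obtain ⟨y, hy⟩ := Abelian.Ext.contravariant_sequence_exact₁ hT Y (Abelian.Ext.mk₀ φ)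
        (add_zero 1) (hc₁ _ h0)
      obtain ⟨ψ, rfl⟩ := (Abelian.Ext.mk₀_bijective _ _).2 y
      exact ⟨ψ, (Abelian.Ext.mk₀_bijective _ _).1 (by rw [← hy, Abelian.Ext.mk₀_comp_mk₀])⟩
    · rintro ⟨ψ, rfl⟩
      change c.comp (hT.extClass.comp (Abelian.Ext.mk₀ (T.f ≫ ψ)) (add_zero 1)) rfl = 0
      rw [← Abelian.Ext.mk₀_comp_mk₀, hT.extClass_comp_assoc, Abelian.Ext.comp_zero]
  · change c.comp (hT.extClass.comp (Abelian.Ext.mk₀ (φ ≫ g)) (add_zero 1)) rfl =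
      (c.comp (hT.extClass.comp (Abelian.Ext.mk₀ φ) (add_zero 1)) rfl).comp _ _
    rw [← Abelian.Ext.mk₀_comp_mk₀, Abelian.Ext.comp_assoc_of_third_deg_zero,
      Abelian.Ext.comp_assoc_of_third_deg_zero]

end Resolutions

end CYRep

namespace CYRep

/-! ### Dimensions of spaces of homomorphisms out of projective bimodules -/

section HomDimension

variable {R k : Type*} [Ring R] [Field k] {P N : Type*} [AddCommGroup P] [Module R P]
  [AddCommGroup N] [Module R N] [Module k N] [SMulCommClass R k N]

/-- Evaluation on a finite family of elements of `P`. -/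
def evalFamily {r : ℕ} (x : Fin r → P) : (P →ₗ[R] N) →ₗ[k] (Fin r → N) where
  toFun h i := h (x i)
  map_add' _ _ := rfl
  map_smul' _ _ := rfl

lemma evalFamily_injective {r : ℕ} {x : Fin r → P} (hx : Submodule.span R (Set.range x) = ⊤) :
    Function.Injective (evalFamily (R := R) (N := N) (k := k) x) := fun _ _ h =>
  LinearMap.ext_on_range hx fun i => congr_fun h i

instance [Module.Finite R P] [FiniteDimensional k N] : FiniteDimensional k (P →ₗ[R] N) := by
  obtain ⟨r, x, hx⟩ := Module.Finite.exists_fin (R := R) (M := P)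
  exact FiniteDimensional.of_injective _ (evalFamily_injective (k := k) (N := N) hx)

/-- Supplies a bound uniform in the representation, so that only finitely many dimensions occur. -/
lemma finrank_hom_le [FiniteDimensional k N] {r : ℕ} {x : Fin r → P}
    (hx : Submodule.span R (Set.range x) = ⊤) :
    Module.finrank k (P →ₗ[R] N) ≤ r * Module.finrank k N := by
  simpa [Module.finrank_pi_fintype] using
    LinearMap.finrank_le_finrank_of_injective (evalFamily_injective (k := k) (N := N) hx)

variable (k) in
/-- `y ↦ (p ↦ φ(p) y)`. -/
def smulRightHom (φ : P →ₗ[R] R) : N →ₗ[k] (P →ₗ[R] N) where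
  toFun y := φ.smulRight y
  map_add' y z := by ext; simp
  map_smul' c y := by ext; simp [smul_comm]

@[simp]
lemma smulRightHom_apply (φ : P →ₗ[R] R) (y : N) (p : P) :
    smulRightHom k φ y p = φ p • y := rfl

lemma sum_smulRightHom {r : ℕ} {x : Fin r → P} {φ : Fin r → P →ₗ[R] R}
    (hx : ∀ p, ∑ i, φ i p • x i = p) (h : P →ₗ[R] N) :
    ∑ i, smulRightHom k (φ i) (h (x i)) = h := by
  ext p
  conv_rhs => rw [← hx p]
  simp [LinearMap.sum_apply]

/-- The dimension of `Hom(P, N)` is the trace on `N` of the trace of `P`. -/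
lemma finrank_hom_eq_sum_trace [FiniteDimensional k N] [Module.Finite R P] {r : ℕ}
    {x : Fin r → P} {φ : Fin r → P →ₗ[R] R} (hx : ∀ p, ∑ i, φ i p • x i = p) :
    (Module.finrank k (P →ₗ[R] N) : k) =
      ∑ i, LinearMap.trace k N (DistribSMul.toLinearMap k N (φ i (x i))) := by
  -- The dual basis writes the identity of `Hom(P, N)` as a sum of maps factoring through `N`;
  -- cyclicity of the trace moves each summand to `N`, where it is the action of `φ i (x i)`.
  have hid : (LinearMap.id : (P →ₗ[R] N) →ₗ[k] (P →ₗ[R] N)) =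
      ∑ i, smulRightHom k (φ i) ∘ₗ LinearMap.applyₗ' k (x i) :=
    LinearMap.ext fun h => by
      simpa [LinearMap.sum_apply] using (sum_smulRightHom (k := k) hx h).symm
  rw [← LinearMap.trace_id, hid, map_sum]
  refine Finset.sum_congr rfl fun i _ => ?_
  rw [LinearMap.trace_comp_comm']
  rfl

end HomDimension

/-! ### Traces as regular functions and local constancy -/

section LocallyConstant

lemma trace_eq_of_intertwines {k V W : Type*} [Field k] [AddCommGroup V] [Module k V]
    [AddCommGroup W] [Module k W] (e : V ≃ₗ[k] W) (f : V →ₗ[k] V) (g : W →ₗ[k] W)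
    (h : ∀ v, g (e v) = e (f v)) : LinearMap.trace k W g = LinearMap.trace k V f := by
  rw [← LinearMap.trace_conj' f e]
  congr 1
  ext w
  rw [LinearEquiv.conj_apply_apply, ← h, LinearEquiv.apply_symm_apply]

/-- The trace of `f ↦ a ∘ f ∘ b` on `End(V)`. -/
lemma trace_mulLeftRight {k V : Type*} [Field k] [AddCommGroup V] [Module k V]
    [FiniteDimensional k V] (a b : Module.End k V) :
    LinearMap.trace k _ (AlgHom.mulLeftRight k (Module.End k V) (a ⊗ₜ MulOpposite.op b)) =
      LinearMap.trace k V a * LinearMap.trace k V b := by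
  -- Under `End(V) ≅ V* ⊗ V` the map `f ↦ a f b` becomes `bᵀ ⊗ a`.
  rw [mul_comm, ← LinearMap.trace_transpose' b, ← LinearMap.trace_tensorProduct']
  refine trace_eq_of_intertwines (k := k) (V := Module.Dual k V ⊗[k] V)
    (W := Module.End k V) (dualTensorHomEquiv k V V) _ _ fun x => ?_
  rw [AlgHom.mulLeftRight_apply]
  induction x using TensorProduct.induction_on with
  | zero => simp
  | add x y hx hy => simp only [map_add, mul_add, add_mul, hx, hy]
  | tmul φ v => ext w; simp [Module.Dual.transpose_apply]

variable {k A : Type u} [Field k] [Ring A] [Algebra k A] {n : ℕ}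

namespace RepPt

variable (M : RepPt k A n)

instance : FiniteDimensional k M.Mod := inferInstanceAs (FiniteDimensional k (Fin n → k))

lemma finrank_mod : Module.finrank k M.Mod = n :=
  Module.finrank_fin_fun k

instance : IsScalarTower k (Env k A) (Module.End k M.Mod) where
  smul_assoc c s f := by simp [env_smul_def]

end RepPt

variable (k A n) in
/-- The regular function `M ↦ tr(s | End_k(M))` attached to `s : Aᵉ`. -/
def envTrace : Env k A →ₗ[k] RepRing k A n :=
  LinearMap.mul' k (RepRing k A n) ∘ₗ
    TensorProduct.map (Matrix.traceLinearMap (Fin n) k (RepRing k A n) ∘ₗ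
      (univRep k A n).toLinearMap)
    (Matrix.traceLinearMap (Fin n) k (RepRing k A n) ∘ₗ (univRep k A n).toLinearMap ∘ₗ
      (MulOpposite.opLinearEquiv k).symm.toLinearMap)

lemma classify_univRep (M : RepPt k A n) (a : A) (i j : Fin n) :
    classify (A := A) (n := n) (B := k) M (univRep k A n a i j) =
      (show A →ₐ[k] Matrix (Fin n) (Fin n) k from M) a i j :=
  classify_mk_X (k := k) (A := A) (n := n) (B := k) M (a, i, j)

lemma classify_trace_univRep (M : RepPt k A n) (a : A) :
    classify (A := A) (n := n) (B := k) M (univRep k A n a).trace =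
      LinearMap.trace k M.Mod (M.toEnd a) := by
  have : LinearMap.trace k M.Mod (M.toEnd a) =
      Matrix.trace ((show A →ₐ[k] Matrix (Fin n) (Fin n) k from M) a) :=
    Matrix.trace_toLin'_eq _
  rw [this]
  simp only [Matrix.trace, map_sum, Matrix.diag, classify_univRep]

lemma classify_envTrace (M : RepPt k A n) (s : Env k A) :
    classify (A := A) (n := n) (B := k) M (envTrace k A n s) =
      LinearMap.trace k _ (DistribSMul.toLinearMap k (Module.End k M.Mod) s) := by
  have h : DistribSMul.toLinearMap k (Module.End k M.Mod) s = M.envAct s := rfl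
  rw [h]
  induction s using TensorProduct.induction_on with
  | zero => simp
  | add s t hs ht => simp [hs rfl, ht rfl]
  | tmul a b =>
    obtain ⟨b, rfl⟩ := MulOpposite.op_surjective b
    have h₁ : M.envAct (a ⊗ₜ MulOpposite.op b) =
      AlgHom.mulLeftRight k _ (M.toEnd a ⊗ₜ MulOpposite.op (M.toEnd b)) := rfl
    rw [h₁, trace_mulLeftRight, ← classify_trace_univRep, ← classify_trace_univRep, ← map_mul]
    rfl

/-- A bounded function with values in `ℕ` that is given by a regular function is locally
constant. -/
lemma isLocallyConstant_of_regular [CharZero k] (g : RepPt k A n → ℕ) (t : RepRing k A n)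
    (ht : ∀ M, (g M : k) = classify (A := A) (n := n) (B := k) M t) (b : ℕ) (hb : ∀ M, g M ≤ b) :
    IsLocallyConstant g := by
  -- Natural numbers stay distinct in `k`, so a fibre is the zero locus of `t - c`. The bound `b`
  -- then makes its complement a finite union of closed fibres.
  have hcl : ∀ c, IsClosed (g ⁻¹' {c}) := fun c => by
    have : g ⁻¹' {c} = RepPt.toSpec ⁻¹' PrimeSpectrum.zeroLocus {t - (c : RepRing k A n)} := by
      ext M
      simp only [Set.mem_preimage, Set.mem_singleton_iff, PrimeSpectrum.mem_zeroLocus,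
        Set.singleton_subset_iff, SetLike.mem_coe]
      change _ ↔ t - (c : RepRing k A n) ∈ RingHom.ker _
      rw [RingHom.mem_ker, map_sub, map_natCast, sub_eq_zero, ← ht, Nat.cast_inj]
    rw [this]
    exact (PrimeSpectrum.isClosed_zeroLocus _).preimage continuous_induced_dom
  refine IsLocallyConstant.iff_isOpen_fiber.2 fun c => ?_
  have : g ⁻¹' {c} = (⋃ i ∈ {i | i ≤ b ∧ i ≠ c}, g ⁻¹' {i})ᶜ := by
    ext M
    simpa using ⟨fun h i _ hi h' => hi (h'.symm.trans h), fun h =>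
      by_contra fun h' => h _ (hb M) h' rfl⟩
  rw [this, isOpen_compl_iff]
  exact ((Set.finite_Iic b).subset fun i hi => hi.1).isClosed_biUnion fun i _ => hcl i

/-- For every finitely generated projective bimodule `P`, the function
`M ↦ dim Hom(P, End_k(M))` is locally constant: it is the trace of an idempotent, hence regular. -/
lemma isLocallyConstant_finrank_hom [CharZero k] (P : Type*) [AddCommGroup P]
    [Module (Env k A) P] [Module.Finite (Env k A) P] [Module.Projective (Env k A) P] :
    IsLocallyConstant fun M : RepPt k A n =>
      Module.finrank k (P →ₗ[Env k A] Module.End k M.Mod) := by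
  obtain ⟨r, x, φ, hx⟩ := exists_finite_dualBasis (R := Env k A) P
  refine isLocallyConstant_of_regular _ (∑ i, envTrace k A n (φ i (x i))) (fun M => ?_)
    (r * (n * n)) (fun M => ?_)
  · rw [finrank_hom_eq_sum_trace hx, map_sum]
    simp only [classify_envTrace]
  · refine (finrank_hom_le (x := x) ?_).trans_eq ?_
    · refine eq_top_iff.2 fun p _ => ?_
      rw [← hx p]
      exact Submodule.sum_mem _ fun i _ =>
        Submodule.smul_mem _ _ (Submodule.subset_span ⟨i, rfl⟩)
    · rw [Module.finrank_linearMap, M.finrank_mod]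

end LocallyConstant

end CYRep

namespace CYRep

/-! ### Derivations -/

section Derivations

variable {k A : Type u} [Field k] [Ring A] [Algebra k A]

variable (k A) in
/-- The multiplication map `Aᵉ → A` as a map of bimodules. -/
def envMul : Env k A →ₗ[Env k A] diagBimod k A :=
  LinearMap.toSpanSingleton (Env k A) (diagBimod k A) (show diagBimod k A from (1 : A))

/-- The value of `envMul` as an element of `A`. -/
def envVal : Env k A →+ A where
  toFun s := (show A from envMul k A s)
  map_zero' := map_zero (envMul k A)
  map_add' := map_add (envMul k A)

lemma envVal_tmul (a b : A) : envVal (k := k) (a ⊗ₜ MulOpposite.op b) = a * b := by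
  have := diagBimod_smul k A a b 1
  rw [mul_one] at this
  exact this

lemma envMul_surjective : Function.Surjective (envMul k A) := fun a =>
  ⟨(show A from a) ⊗ₜ MulOpposite.op 1, (envVal_tmul (k := k) (show A from a) 1).trans (mul_one _)⟩

variable (k A) in
/-- Derivations of `A` with values in the bimodule `N`. -/
def bimodDer (N : Type*) [AddCommGroup N] [Module k N] [Module (Env k A) N]
    [SMulCommClass (Env k A) k N] : Submodule k (A →ₗ[k] N) where
  carrier := {δ | ∀ a b : A, δ (a * b) =
    (a ⊗ₜ[k] MulOpposite.op (1 : A) : Env k A) • δ b +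
      ((1 : A) ⊗ₜ[k] MulOpposite.op b : Env k A) • δ a}
  add_mem' {δ ε} hδ hε a b := by
    simp only [LinearMap.add_apply, hδ a b, hε a b, smul_add]
    abel
  zero_mem' a b := by simp
  smul_mem' c δ hδ a b := by
    simp only [LinearMap.smul_apply, hδ a b, smul_add]
    rw [← smul_comm _ c, ← smul_comm _ c]

variable {N : Type*} [AddCommGroup N] [Module k N] [Module (Env k A) N]
    [SMulCommClass (Env k A) k N] [IsScalarTower k (Env k A) N]

variable (k) in
/-- The noncommutative differential `da = a ⊗ 1 - 1 ⊗ a`. -/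
def ncDiff (a : A) : LinearMap.ker (envMul k A) :=
  ⟨a ⊗ₜ MulOpposite.op 1 - 1 ⊗ₜ MulOpposite.op a, by
    rw [LinearMap.mem_ker, map_sub, sub_eq_zero]
    exact (envVal_tmul (k := k) a 1).trans
      ((mul_one a).trans ((one_mul a).symm.trans (envVal_tmul (k := k) 1 a).symm))⟩

/-- The derivation attached to a bimodule map `Ω → N`. -/
def derOfHom : (LinearMap.ker (envMul k A) →ₗ[Env k A] N) →ₗ[k] bimodDer k A N where
  toFun h :=
    ⟨{ toFun := fun a => h (ncDiff k a)
       map_add' := fun a b => by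
        rw [← map_add]
        congr 1
        ext
        simp only [ncDiff, Submodule.coe_add, TensorProduct.add_tmul, MulOpposite.op_add,
          TensorProduct.tmul_add]
        abel
       map_smul' := fun c a => by
        have : ncDiff k (c • a) = (algebraMap k (Env k A) c) • ncDiff k a := by
          ext
          simp only [ncDiff, Submodule.coe_smul, ← Algebra.smul_def, smul_sub, smul_eq_mul,
            TensorProduct.smul_tmul', MulOpposite.op_smul, TensorProduct.tmul_smul]
        rw [this, map_smul, algebraMap_smul]
        rfl },
     fun a b => by
      change h _ = _ • h _ + _ • h _
      rw [← map_smul, ← map_smul, ← map_add]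
      congr 1
      ext
      simp [ncDiff, mul_sub, ← MulOpposite.op_mul]⟩
  map_add' _ _ := rfl
  map_smul' _ _ := rfl

lemma derOfHom_apply (h : LinearMap.ker (envMul k A) →ₗ[Env k A] N) (a : A) :
    (derOfHom h : A →ₗ[k] N) a = h (ncDiff k a) := rfl

/-- The `k`-linear map `Aᵉ → N`, `a ⊗ b ↦ -a δ(b)`. -/
def extDer (δ : A →ₗ[k] N) : Env k A →ₗ[k] N :=
  TensorProduct.lift <| LinearMap.mk₂ k
    (fun (a : A) (b : Aᵐᵒᵖ) => -((a ⊗ₜ[k] MulOpposite.op (1 : A) : Env k A) • δ b.unop))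
    (fun a a' b => by simp [TensorProduct.add_tmul, add_smul, add_comm])
    (fun c a b => by simp [← TensorProduct.smul_tmul'])
    (fun a b b' => by simp [add_comm])
    (fun c a b => by simp [smul_comm _ c])

lemma extDer_tmul (δ : A →ₗ[k] N) (a b : A) : extDer δ (a ⊗ₜ MulOpposite.op b) =
    -((a ⊗ₜ[k] MulOpposite.op (1 : A) : Env k A) • δ b) := rfl

/-- The defect of `Aᵉ`-linearity involves `s` only through its image in `A`, so it disappears on
`Ω`. -/
lemma extDer_mul {δ : A →ₗ[k] N} (hδ : δ ∈ bimodDer k A N) (a b : A) (s : Env k A) :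
    extDer δ ((a ⊗ₜ MulOpposite.op b) * s) =
      (a ⊗ₜ[k] MulOpposite.op b : Env k A) • extDer δ s -
      ((a * envVal s) ⊗ₜ[k] MulOpposite.op (1 : A) : Env k A) • δ b := by
  induction s using TensorProduct.induction_on with
  | zero =>
    rw [mul_zero, map_zero, map_zero, mul_zero, TensorProduct.zero_tmul, smul_zero, zero_sub]
    exact (neg_eq_zero.2 (zero_smul (Env k A) (δ b))).symm
  | add s t hs ht =>
    rw [mul_add, map_add, hs, ht, map_add, map_add, mul_add, TensorProduct.add_tmul, add_smul, smul_add]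
    abel
  | tmul c d =>
    obtain ⟨d, rfl⟩ := MulOpposite.op_surjective d
    rw [envVal_tmul, Algebra.TensorProduct.tmul_mul_tmul, ← MulOpposite.op_mul, extDer_tmul,
      extDer_tmul, hδ d b, smul_add, smul_neg, smul_smul, smul_smul, smul_smul]
    simp only [Algebra.TensorProduct.tmul_mul_tmul, ← MulOpposite.op_mul, mul_one, one_mul, mul_assoc]
    abel

/-- The bimodule map `Ω → N` attached to a derivation. -/
def homOfDer (δ : bimodDer k A N) : LinearMap.ker (envMul k A) →ₗ[Env k A] N where
  toFun x := extDer δ.1 x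
  map_add' x y := map_add _ _ _
  map_smul' s x := by
    have hx : envVal (x : Env k A) = 0 := x.2
    induction s using TensorProduct.induction_on with
    | zero =>
      refine Eq.trans ?_ (zero_smul (Env k A) (extDer δ.1 (x : Env k A))).symm
      rw [Submodule.coe_smul, smul_eq_mul, zero_mul, map_zero]
    | add s t hs ht => simpa [add_mul, add_smul] using congr_arg₂ (· + ·) hs ht
    | tmul a b =>
      obtain ⟨b, rfl⟩ := MulOpposite.op_surjective b
      rw [Submodule.coe_smul, smul_eq_mul, extDer_mul δ.2, hx, mul_zero, TensorProduct.zero_tmul]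
      exact sub_eq_self.2 (zero_smul (Env k A) (δ.1 b))

/-- Rests on `a ⊗ b - ab ⊗ 1 = -(a ⊗ 1) db`. On `Ω` the correction vanishes, so the differentials
generate. -/
lemma sub_envVal_tmul_mem_span_ncDiff (s : Env k A) :
    s - envVal s ⊗ₜ MulOpposite.op (1 : A) ∈
      (Submodule.span (Env k A) (Set.range (ncDiff k (A := A)))).map
        (LinearMap.ker (envMul k A)).subtype := by
  induction s using TensorProduct.induction_on with
  | zero =>
    simp
  | add s t hs ht =>
    rw [map_add, TensorProduct.add_tmul, add_sub_add_comm]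
    exact add_mem hs ht
  | tmul a b =>
    obtain ⟨b, rfl⟩ := MulOpposite.op_surjective b
    rw [envVal_tmul]
    refine ⟨((-a) ⊗ₜ MulOpposite.op (1 : A) : Env k A) • ncDiff k b,
      Submodule.smul_mem _ _ (Submodule.subset_span ⟨b, rfl⟩), ?_⟩
    rw [Submodule.subtype_apply, Submodule.coe_smul, smul_eq_mul, ncDiff, mul_sub,
      Algebra.TensorProduct.tmul_mul_tmul, Algebra.TensorProduct.tmul_mul_tmul,
      ← MulOpposite.op_mul, ← MulOpposite.op_mul, neg_mul, neg_mul, TensorProduct.neg_tmul,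
      TensorProduct.neg_tmul, mul_one, mul_one, mul_one]
    abel

lemma span_ncDiff : Submodule.span (Env k A) (Set.range (ncDiff k (A := A))) = ⊤ := by
  refine eq_top_iff.2 fun x _ => ?_
  obtain ⟨y, hy, h⟩ := sub_envVal_tmul_mem_span_ncDiff (x : Env k A)
  have hx : envVal (x : Env k A) = 0 := x.2
  rw [hx, TensorProduct.zero_tmul, sub_zero] at h
  rwa [← Subtype.ext h]

/-- `Hom(Ω, N) = Der(A, N)`. -/
lemma derOfHom_bijective : Function.Bijective (derOfHom (k := k) (A := A) (N := N)) := by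
  refine ⟨fun h h' e => LinearMap.ext_on_range span_ncDiff fun a => ?_, fun δ => ⟨homOfDer δ, ?_⟩⟩
  · rw [← derOfHom_apply, e, derOfHom_apply]
  · have h1 : δ.1 1 = 0 := by simpa [← Algebra.TensorProduct.one_def] using δ.2 1 1
    ext a
    change extDer δ.1 (a ⊗ₜ MulOpposite.op 1 - 1 ⊗ₜ MulOpposite.op a) = _
    rw [map_sub, extDer_tmul, extDer_tmul, h1]
    rw [smul_zero, neg_zero, zero_sub, neg_neg]
    exact one_smul (Env k A) (δ.1 a)

end Derivations

end CYRep

namespace CYRep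

/-! ### The tangent space of the representation scheme -/

section Tangent

lemma isScalarTower_cotangent (k : Type*) {R : Type*} [CommRing k] [CommRing R] [Algebra k R]
    (I : Ideal R) : IsScalarTower k R I.Cotangent := inferInstance

variable {k A : Type u} [Field k] [Ring A] [Algebra k A] {n : ℕ}

namespace RepPt

variable (M : RepPt k A n)

instance : IsScalarTower k (RepRing k A n) M.maxIdeal.Cotangent :=
  isScalarTower_cotangent k M.maxIdeal

/-- The value of a regular function at `M`. -/
def evalAt : RepRing k A n →ₐ[k] k := classify (A := A) (n := n) (B := k) M

/-- The matrix of `a` in the representation `M`. -/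
def mat : A →ₐ[k] Matrix (Fin n) (Fin n) k := M

lemma evalAt_univRep (a : A) (i j : Fin n) : M.evalAt (univRep k A n a i j) = M.mat a i j :=
  classify_univRep M a i j

/-- The differential at `M` of a regular function. -/
def diffAt : RepRing k A n →ₗ[k] M.maxIdeal.Cotangent where
  toFun v := M.maxIdeal.toCotangent ⟨v - algebraMap k _ (M.evalAt v), by
    change M.evalAt _ = 0
    simp⟩
  map_add' v w := by
    rw [← map_add]
    congr 1
    ext
    simp only [map_add, Submodule.coe_add]
    ring
  map_smul' c v := by
    rw [← LinearMap.map_smul_of_tower]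
    congr 1
    ext
    simp only [map_smul, RingHom.id_apply, Submodule.coe_smul_of_tower, smul_sub, smul_eq_mul, map_mul]
    rw [← Algebra.smul_def]

lemma diffAt_of_mem (v : M.maxIdeal) : M.diffAt v = M.maxIdeal.toCotangent v := by
  have h : M.evalAt v = 0 := v.2
  change M.maxIdeal.toCotangent _ = _
  congr 1
  ext
  simp [h]

/-- Leibniz rule: the two sides differ by `(v - v(M)) (w - w(M))`, which lies in the square of the
maximal ideal. -/
lemma diffAt_mul (v w : RepRing k A n) :
    M.diffAt (v * w) = M.evalAt v • M.diffAt w + M.evalAt w • M.diffAt v := by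
  change M.maxIdeal.toCotangent _ = _ • M.maxIdeal.toCotangent _ + _ • M.maxIdeal.toCotangent _
  rw [← LinearMap.map_smul_of_tower, ← LinearMap.map_smul_of_tower, ← map_add,
    Ideal.toCotangent_eq]
  have hv : v - algebraMap k _ (M.evalAt v) ∈ M.maxIdeal := by
    change M.evalAt _ = 0
    simp
  have hw : w - algebraMap k _ (M.evalAt w) ∈ M.maxIdeal := by
    change M.evalAt _ = 0
    simp
  rw [pow_two]
  convert Ideal.mul_mem_mul hv hw using 1
  have hs : ∀ (c : k) (x : RepRing k A n), c • x = algebraMap k _ c * x := fun c x =>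
    (Algebra.smul_def (A := RepRing k A n) c x :)
  simp only [map_mul, Submodule.coe_add, Submodule.coe_smul_of_tower, hs]
  ring

@[simp]
lemma diffAt_algebraMap (c : k) : M.diffAt (algebraMap k _ c) = 0 := by
  change M.maxIdeal.toCotangent _ = _
  rw [Ideal.toCotangent_eq_zero]
  simp

/-- A tangent vector is determined by its values on the matrix coefficients. -/
lemma tangent_ext {ψ : M.TangentSpace}
    (h : ∀ a i j, ψ (M.diffAt (univRep k A n a i j)) = 0) : ψ = 0 := by
  have key : ∀ v, ψ (M.diffAt v) = 0 := fun v => by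
    obtain ⟨p, rfl⟩ := Ideal.Quotient.mk_surjective v
    induction p using MvPolynomial.induction_on with
    | C c =>
      have := M.diffAt_algebraMap c
      exact (congr_arg ψ this).trans (map_zero ψ)
    | add p q hp hq => rw [map_add, map_add, map_add, hp, hq, add_zero]
    | mul_X p x hp =>
      have hx := h x.1 x.2.1 x.2.2
      change ψ (M.diffAt (Ideal.Quotient.mk (repIdeal k A n) (MvPolynomial.X x))) = 0 at hx
      rw [map_mul, diffAt_mul, map_add, map_smul, map_smul, hp, hx, smul_zero, smul_zero, add_zero]
  ext c
  obtain ⟨v, rfl⟩ := Ideal.toCotangent_surjective _ c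
  rw [← diffAt_of_mem, key]
  rfl

lemma tmul_one_smul (a : A) (f : Module.End k M.Mod) :
    (a ⊗ₜ[k] MulOpposite.op (1 : A) : Env k A) • f = M.toEnd a * f := by
  ext v
  rw [tmul_smul_apply, one_smul]
  rfl

lemma one_tmul_smul (a : A) (f : Module.End k M.Mod) :
    ((1 : A) ⊗ₜ[k] MulOpposite.op a : Env k A) • f = f * M.toEnd a := by
  ext v
  rw [tmul_smul_apply, one_smul]
  rfl

lemma mem_bimodDer_iff (δ : A →ₗ[k] Module.End k M.Mod) :
    δ ∈ bimodDer k A (Module.End k M.Mod) ↔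
      ∀ a b, δ (a * b) = M.toEnd a * δ b + δ a * M.toEnd b := by
  refine forall₂_congr fun a b => ?_
  rw [tmul_one_smul, one_tmul_smul]

/-- The identification of matrices with endomorphisms of `M`. -/
def matEquiv : Matrix (Fin n) (Fin n) k ≃ₐ[k] Module.End k M.Mod :=
  Matrix.toLinAlgEquiv' (R := k) (n := Fin n)

lemma toEnd_eq (a : A) : M.toEnd a = M.matEquiv (M.mat a) := rfl

/-- The derivation attached to a tangent vector. -/
def derOfTangent : M.TangentSpace →ₗ[k] bimodDer k A (Module.End k M.Mod) where
  toFun ψ := ⟨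
    { toFun := fun a => M.matEquiv (Matrix.of fun i j => ψ (M.diffAt (univRep k A n a i j)))
      map_add' := fun a b => by
        rw [← map_add]
        congr 1
        ext i j
        simp
      map_smul' := fun c a => by
        rw [RingHom.id_apply, ← map_smul]
        congr 1
        ext i j
        simp }, by
    rw [mem_bimodDer_iff]
    intro a b
    change M.matEquiv _ = M.toEnd a * M.matEquiv _ + M.matEquiv _ * M.toEnd b
    rw [toEnd_eq, toEnd_eq, ← map_mul, ← map_mul, ← map_add]
    congr 1
    ext i j
    simp only [map_mul, Matrix.mul_apply, Matrix.of_apply, map_sum, diffAt_mul, map_add, map_smul,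
      Matrix.add_apply, evalAt_univRep, Finset.sum_add_distrib, smul_eq_mul, mul_comm]⟩
  map_add' ψ χ := by
    ext a : 2
    change M.matEquiv _ = M.matEquiv _ + M.matEquiv _
    rw [← map_add]
    rfl
  map_smul' c ψ := by
    ext a : 2
    change M.matEquiv _ = c • M.matEquiv _
    rw [← map_smul]
    rfl

lemma derOfTangent_apply (ψ : M.TangentSpace) (a : A) :
    (M.derOfTangent ψ : A →ₗ[k] Module.End k M.Mod) a =
      M.matEquiv (Matrix.of fun i j => ψ (M.diffAt (univRep k A n a i j))) := rfl

/-- The first order deformation of `M` along a derivation. -/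
def deform (δ : bimodDer k A (Module.End k M.Mod)) :
    A →ₐ[k] Matrix (Fin n) (Fin n) (DualNumber k) :=
  AlgHom.ofLinearMap
    { toFun := fun a => Matrix.of fun i j =>
        (TrivSqZeroExt.inl (M.mat a i j) + TrivSqZeroExt.inr (M.matEquiv.symm (δ.1 a) i j) :
          DualNumber k)
      map_add' := fun a b => by
        ext i j <;> simp
      map_smul' := fun c a => by
        ext i j <;> simp }
    (by
      have h1 : δ.1 1 = 0 := by simpa using (M.mem_bimodDer_iff δ.1).1 δ.2 1 1
      ext i j <;> by_cases hij : i = j <;>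
        simp [h1, hij, Matrix.one_apply])
    (fun a b => by
      ext i j
      · simp [Matrix.mul_apply, TrivSqZeroExt.fst_sum]
      · simp [Matrix.mul_apply, TrivSqZeroExt.snd_sum, (M.mem_bimodDer_iff δ.1).1 δ.2 a b, toEnd_eq,
          Finset.sum_add_distrib, mul_comm])

lemma deform_apply (δ : bimodDer k A (Module.End k M.Mod)) (a : A) (i j : Fin n) :
    M.deform δ a i j =
      TrivSqZeroExt.inl (M.mat a i j) + TrivSqZeroExt.inr (M.matEquiv.symm (δ.1 a) i j) := rfl

lemma fst_classify_deform (δ : bimodDer k A (Module.End k M.Mod)) (v : RepRing k A n) :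
    (classify (M.deform δ) v).fst = M.evalAt v := by
  have : (TrivSqZeroExt.fstHom k k k).comp (classify (M.deform δ)) = M.evalAt := by
    refine (repEquiv k A n k).injective (AlgHom.ext fun a => ?_)
    ext i j
    change (classify (M.deform δ) (univRep k A n a i j)).fst = M.evalAt (univRep k A n a i j)
    rw [evalAt_univRep]
    refine (congr_arg TrivSqZeroExt.fst (classify_mk_X (M.deform δ) (a, i, j))).trans ?_
    simp [deform_apply]
  exact DFunLike.congr_fun this v

/-- Injectivity holds because the matrix coefficients generate the coordinate ring; the inverse
takes a derivation to the `ε`-part of the dual-number point that it defines. -/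
lemma derOfTangent_bijective : Function.Bijective M.derOfTangent := by
  refine ⟨(injective_iff_map_eq_zero _).2 fun ψ hψ => M.tangent_ext fun a i j => ?_, fun δ => ?_⟩
  · have h := M.derOfTangent_apply ψ a
    rw [hψ] at h
    have h' := (map_eq_zero_iff M.matEquiv M.matEquiv.injective).1 h.symm
    exact congr_fun (congr_fun h' i) j
  · let τ : RepRing k A n →ₗ[k] k :=
      (TrivSqZeroExt.sndHom k k).restrictScalars k ∘ₗ (classify (M.deform δ)).toLinearMap
    have hτ : ∀ v, τ v = (classify (M.deform δ) v).snd := fun _ => rfl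
    let q : M.maxIdeal →ₗ[k] M.maxIdeal.Cotangent := M.maxIdeal.toCotangent.restrictScalars k
    have hq : Function.Surjective q := Ideal.toCotangent_surjective _
    -- The maximal ideal maps into `(ε)`, and `ε² = 0`, so `τ` kills its square and descends to the
    -- cotangent space.
    have hle : LinearMap.ker q ≤ LinearMap.ker (τ ∘ₗ M.maxIdeal.subtype.restrictScalars k) := by
      intro v hv
      have hv' : (v : RepRing k A n) ∈ M.maxIdeal ^ 2 := (Ideal.toCotangent_eq_zero _ v).1 hv
      change τ v = 0
      rw [pow_two] at hv'
      generalize (v : RepRing k A n) = w at hv'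
      induction hv' using Submodule.mul_induction_on' with
      | mem_mul_mem x hx y hy =>
        have hx' : M.evalAt x = 0 := hx
        have hy' : M.evalAt y = 0 := hy
        rw [hτ, map_mul, TrivSqZeroExt.snd_mul, fst_classify_deform, fst_classify_deform, hx', hy']
        simp
      | add x _ y _ hx hy => rw [map_add, hx, hy, add_zero]
    let ψ : M.TangentSpace :=
      (LinearMap.ker q).liftQ _ hle ∘ₗ (q.quotKerEquivOfSurjective hq).symm.toLinearMap
    have hψ : ∀ v : M.maxIdeal, ψ (M.maxIdeal.toCotangent v) = τ v := fun v => by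
      have : (q.quotKerEquivOfSurjective hq).symm (M.maxIdeal.toCotangent v) =
          (LinearMap.ker q).mkQ v := by
        rw [LinearEquiv.symm_apply_eq]
        rfl
      change (LinearMap.ker q).liftQ _ hle ((q.quotKerEquivOfSurjective hq).symm _) = _
      rw [this]
      rfl
    refine ⟨ψ, ?_⟩
    ext a : 2
    rw [derOfTangent_apply, ← AlgEquiv.eq_symm_apply]
    ext i j
    refine (hψ _).trans ?_
    change τ (_ - _) = _
    rw [map_sub, hτ, hτ, AlgHom.commutes]
    have : (classify (M.deform δ) (univRep k A n a i j)) = M.deform δ a i j :=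
      classify_mk_X (M.deform δ) (a, i, j)
    rw [this, deform_apply]
    simp [TrivSqZeroExt.algebraMap_eq_inl]

lemma finrank_tangentSpace : Module.finrank k M.TangentSpace =
    Module.finrank k (LinearMap.ker (envMul k A) →ₗ[Env k A] Module.End k M.Mod) :=
  ((LinearEquiv.ofBijective _ M.derOfTangent_bijective).trans
    (LinearEquiv.ofBijective _ derOfHom_bijective).symm).finrank_eq

end RepPt

end Tangent

end CYRep

namespace CYRep

/-! ### Left exactness of `Hom(-, N)` and Schanuel's lemma in dimensions -/

section Restriction

variable {R k : Type*} [Ring R] [Field k] {X₁ X₂ X₃ N : Type*} [AddCommGroup X₁] [Module R X₁]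
  [AddCommGroup X₂] [Module R X₂] [AddCommGroup X₃] [Module R X₃]
  [AddCommGroup N] [Module R N] [Module k N] [SMulCommClass R k N]

variable (k N) in
/-- Precomposition with `i` as a `k`-linear map. -/
def precompHom (i : X₁ →ₗ[R] X₂) : (X₂ →ₗ[R] N) →ₗ[k] (X₁ →ₗ[R] N) where
  toFun h := h ∘ₗ i
  map_add' _ _ := rfl
  map_smul' _ _ := rfl

@[simp]
lemma precompHom_apply (i : X₁ →ₗ[R] X₂) (h : X₂ →ₗ[R] N) : precompHom k N i h = h ∘ₗ i := rfl

lemma precompHom_smulRightHom (i : X₁ →ₗ[R] X₂) (φ : X₂ →ₗ[R] R) (y : N) :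
    precompHom k N i (smulRightHom k φ y) = smulRightHom k (φ ∘ₗ i) y := rfl

/-- Left exactness of `Hom(-, N)`, in terms of dimensions. -/
lemma finrank_hom_add_finrank_range [Module.Finite R X₂] [FiniteDimensional k N]
    (i : X₁ →ₗ[R] X₂) (p : X₂ →ₗ[R] X₃) (hex : Function.Exact i p) (hp : Function.Surjective p) :
    Module.finrank k (X₃ →ₗ[R] N) + Module.finrank k (LinearMap.range (precompHom k N i)) =
      Module.finrank k (X₂ →ₗ[R] N) := by
  have hinj : Function.Injective (precompHom k N p) := fun h h' e => by
    ext x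
    obtain ⟨y, rfl⟩ := hp x
    exact LinearMap.congr_fun e y
  have hker : LinearMap.range (precompHom k N p) = LinearMap.ker (precompHom k N i) := by
    ext h
    constructor
    · rintro ⟨h, rfl⟩
      ext x
      simp [hex.apply_apply_eq_zero]
    · intro hh
      have hle : LinearMap.range i ≤ LinearMap.ker h := by
        rintro _ ⟨x, rfl⟩
        exact LinearMap.congr_fun hh x
      refine ⟨(LinearMap.range i).liftQ h hle ∘ₗ
        (hex.linearEquivOfSurjective hp).symm.toLinearMap, ?_⟩
      ext x
      have : (hex.linearEquivOfSurjective hp).symm (p x) = (LinearMap.range i).mkQ x := by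
        rw [LinearEquiv.symm_apply_eq]
        rfl
      simp [this]
  rw [← LinearMap.finrank_range_add_finrank_ker (precompHom k N i), ← hker,
    LinearMap.finrank_range_of_inj hinj, add_comm]

/-- Schanuel's lemma, in terms of dimensions. -/
lemma finrank_hom_schanuel [Module.Finite R X₁] [Module.Finite R X₂] [Module.Projective R X₂]
    [FiniteDimensional k N] {Q : Type*} [AddCommGroup Q] [Module R Q] [Module.Finite R Q]
    [Module.Projective R Q] (i : X₁ →ₗ[R] X₂) (p : X₂ →ₗ[R] X₃) (hi : Function.Injective i)
    (hex : Function.Exact i p) (hp : Function.Surjective p) (q : Q →ₗ[R] X₃)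
    (hq : Function.Surjective q) :
    Module.finrank k (X₁ →ₗ[R] N) + Module.finrank k (Q →ₗ[R] N) =
      Module.finrank k (LinearMap.ker q →ₗ[R] N) + Module.finrank k (X₂ →ₗ[R] N) := by
  obtain ⟨e⟩ := exists_schanuel_equiv p q hp hq
  let e₁ : X₁ ≃ₗ[R] LinearMap.ker p := (LinearEquiv.ofInjective i hi).trans
    (LinearEquiv.ofEq _ _ (LinearMap.exact_iff.1 hex).symm)
  let E : ((X₁ →ₗ[R] N) × (Q →ₗ[R] N)) ≃ₗ[k] ((LinearMap.ker q →ₗ[R] N) × (X₂ →ₗ[R] N)) :=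
    (LinearMap.coprodEquiv k).trans ((LinearEquiv.congrLeft N k
      ((e₁.prodCongr (LinearEquiv.refl R Q)).trans e)).trans (LinearMap.coprodEquiv k).symm)
  -- Needed for dimensions of the product to add. It is read off from `E`, since no finite
  -- generation of `ker q` is assumed.
  have : FiniteDimensional k (LinearMap.ker q →ₗ[R] N) :=
    Module.Finite.of_surjective (LinearMap.fst k _ (X₂ →ₗ[R] N) ∘ₗ E.toLinearMap)
      (Prod.fst_surjective.comp E.surjective)
  rw [← Module.finrank_prod, ← Module.finrank_prod, E.finrank_eq]

end Restriction

/-! ### Duality -/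

section Duality

/-- Nondegeneracy of the trace form, tested on rank-one endomorphisms: `tr(g (φ ⊗ v)) = φ(g v)`. -/
lemma eq_zero_of_trace_mul_eq_zero {k V : Type*} [Field k] [AddCommGroup V] [Module k V]
    [FiniteDimensional k V] (g : Module.End k V) (h : ∀ y, LinearMap.trace k V (g * y) = 0) :
    g = 0 := by
  ext v
  refine (Module.forall_dual_apply_eq_zero_iff k (g v)).1 fun φ => ?_
  have : g * dualTensorHom k V V (φ ⊗ₜ v) = dualTensorHom k V V (φ ⊗ₜ g v) := by
    ext w
    simp
  have h' := h (dualTensorHom k V V (φ ⊗ₜ v))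
  rw [this, LinearMap.trace_eq_contract_apply, contractLeft_apply] at h'
  exact h'

/-- Every functional on `End(V)` is of the form `y ↦ tr(g y)`. -/
lemma exists_trace_mul_eq {k V : Type*} [Field k] [AddCommGroup V] [Module k V]
    [FiniteDimensional k V] (l : Module.Dual k (Module.End k V)) :
    ∃ g : Module.End k V, ∀ y, LinearMap.trace k V (g * y) = l y := by
  let B : Module.End k V →ₗ[k] Module.Dual k (Module.End k V) :=
    (LinearMap.mul k (Module.End k V)).compr₂ (LinearMap.trace k V)
  have hB : Function.Injective B := (injective_iff_map_eq_zero _).2 fun g hg =>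
    eq_zero_of_trace_mul_eq_zero g fun y => LinearMap.congr_fun hg y
  obtain ⟨g, hg⟩ := (LinearMap.injective_iff_surjective_of_finrank_eq_finrank
    (Subspace.dual_finrank_eq (K := k) (V := Module.End k V)).symm).1 hB l
  exact ⟨g, LinearMap.congr_fun hg⟩

variable {k A : Type u} [Field k] [Ring A] [Algebra k A] {n : ℕ}

lemma rightMul_comp_apply {P : Type*} [AddCommGroup P] [Module (Env k A) P]
    (φ : P →ₗ[Env k A] Env k A) (s : Env k A) (p : P) :
    (LinearMap.toSpanSingleton (Env k A) (Env k A) s ∘ₗ φ) p = φ p * s := rfl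

lemma smulRightHom_rightMul {P N : Type*} [AddCommGroup P] [Module (Env k A) P] [AddCommGroup N]
    [Module k N] [Module (Env k A) N] [SMulCommClass (Env k A) k N]
    (φ : P →ₗ[Env k A] Env k A) (s : Env k A) (y : N) :
    smulRightHom k (LinearMap.toSpanSingleton (Env k A) (Env k A) s ∘ₗ φ) y =
      smulRightHom k φ (s • y) := by
  ext p
  rw [smulRightHom_apply, smulRightHom_apply, rightMul_comp_apply, mul_smul]

namespace RepPt

variable (M : RepPt k A n)

instance : IsScalarTower k A M.Mod where
  smul_assoc c a v := by simp [smul_def]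

lemma tmul_smul (a b : A) (y : Module.End k M.Mod) :
    (a ⊗ₜ[k] MulOpposite.op b : Env k A) • y = M.toEnd a * y * M.toEnd b := by
  ext v
  rw [tmul_smul_apply]
  rfl

variable {P Q : Type*} [AddCommGroup P] [Module (Env k A) P] [AddCommGroup Q] [Module (Env k A) Q]
  {e : (P →ₗ[Env k A] Env k A) →+ A}

/-- The functional on `Hom(P, End_k(M))` attached to an endomorphism of `M`, where `e` maps the
functionals on `P` to `A`. -/
def dualPairing {r : ℕ} (x : Fin r → P) (φ : Fin r → P →ₗ[Env k A] Env k A)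
    (e : (P →ₗ[Env k A] Env k A) →+ A) :
    Module.End A M.Mod →ₗ[k] Module.Dual k (P →ₗ[Env k A] Module.End k M.Mod) :=
  LinearMap.mk₂ k (fun f h => ∑ i, LinearMap.trace k M.Mod
      (LinearMap.restrictScalars k f * M.toEnd (e (φ i)) * h (x i)))
    (fun f g h => by
      rw [← Finset.sum_add_distrib]
      refine Finset.sum_congr rfl fun i _ => ?_
      rw [← map_add, ← add_mul, ← add_mul]
      rfl)
    (fun c f h => by
      rw [Finset.smul_sum]
      refine Finset.sum_congr rfl fun i _ => ?_
      rw [← map_smul, ← smul_mul_assoc, ← smul_mul_assoc]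
      rfl)
    (fun f h h' => by simp [mul_add, Finset.sum_add_distrib])
    (fun c f h => by simp [Finset.mul_sum])

lemma dualPairing_apply {r : ℕ} (x : Fin r → P) (φ : Fin r → P →ₗ[Env k A] Env k A)
    (f : Module.End A M.Mod) (h : P →ₗ[Env k A] Module.End k M.Mod) :
    M.dualPairing x φ e f h = ∑ i, LinearMap.trace k M.Mod
      (LinearMap.restrictScalars k f * M.toEnd (e (φ i)) * h (x i)) := rfl

/-- The pairing is balanced over `Aᵉ`: in `tr(f e(ξ) a y b)` the factor `b` cycles to the front and
passes `f`, which is `A`-linear, leaving `b e(ξ) a`. -/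
lemma trace_pairing_smul (he : ∀ (a b : A) (ξ : P →ₗ[Env k A] Env k A),
      e (LinearMap.toSpanSingleton (Env k A) (Env k A) (a ⊗ₜ MulOpposite.op b) ∘ₗ ξ) =
        b * e ξ * a)
    (f : Module.End A M.Mod) (ξ : P →ₗ[Env k A] Env k A) (s : Env k A) (y : Module.End k M.Mod) :
    LinearMap.trace k M.Mod (LinearMap.restrictScalars k f * M.toEnd (e ξ) * (s • y)) =
      LinearMap.trace k M.Mod (LinearMap.restrictScalars k f *
        M.toEnd (e (LinearMap.toSpanSingleton (Env k A) (Env k A) s ∘ₗ ξ)) * y) := by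
  induction s using TensorProduct.induction_on with
  | zero =>
    have h0 : LinearMap.toSpanSingleton (Env k A) (Env k A) 0 ∘ₗ ξ = 0 := by
      ext p
      exact mul_zero (ξ p)
    have h1 : (0 : Env k A) • y = 0 := zero_smul (Env k A) y
    refine (congr_arg (fun z => LinearMap.trace k M.Mod (_ * z)) h1).trans ?_
    refine Eq.trans ?_ (congr_arg (fun z => LinearMap.trace k M.Mod
      (LinearMap.restrictScalars k f * M.toEnd (e z) * y)) h0).symm
    simp
  | add s t hs ht =>
    have h0 : LinearMap.toSpanSingleton (Env k A) (Env k A) (s + t) ∘ₗ ξ =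
        LinearMap.toSpanSingleton (Env k A) (Env k A) s ∘ₗ ξ +
          LinearMap.toSpanSingleton (Env k A) (Env k A) t ∘ₗ ξ := by
      ext p
      exact mul_add (ξ p) s t
    rw [h0, add_smul, mul_add, map_add, hs, ht, map_add, map_add, mul_add, add_mul, map_add]
  | tmul a b =>
    obtain ⟨b, rfl⟩ := MulOpposite.op_surjective b
    have hf : M.toEnd b * LinearMap.restrictScalars k f =
        LinearMap.restrictScalars k f * M.toEnd b := by
      ext v
      exact (map_smul f b v).symm
    rw [he, tmul_smul, ← mul_assoc, LinearMap.trace_mul_comm, map_mul M.toEnd, map_mul M.toEnd]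
    simp only [← mul_assoc, hf]

/-- Gives the pairing free of the chosen dual basis: on `ξ ⊗ y` it is `tr(f e(ξ) y)`. -/
lemma dualPairing_smulRightHom {r : ℕ} {x : Fin r → P} {φ : Fin r → P →ₗ[Env k A] Env k A}
    (hx : ∀ p, ∑ i, φ i p • x i = p)
    (he : ∀ (a b : A) (ξ : P →ₗ[Env k A] Env k A),
      e (LinearMap.toSpanSingleton (Env k A) (Env k A) (a ⊗ₜ MulOpposite.op b) ∘ₗ ξ) =
        b * e ξ * a)
    (f : Module.End A M.Mod) (ξ : P →ₗ[Env k A] Env k A) (y : Module.End k M.Mod) :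
    M.dualPairing x φ e f (smulRightHom k ξ y) =
      LinearMap.trace k M.Mod (LinearMap.restrictScalars k f * M.toEnd (e ξ) * y) := by
  have hξ : ∑ i, LinearMap.toSpanSingleton (Env k A) (Env k A) (ξ (x i)) ∘ₗ φ i = ξ := by
    ext p
    conv_rhs => rw [← hx p, map_sum]
    rw [LinearMap.sum_apply]
    refine Finset.sum_congr rfl fun i _ => ?_
    rw [map_smul]
    rfl
  conv_rhs => rw [← hξ, map_sum, map_sum, Finset.mul_sum, Finset.sum_mul, map_sum]
  rw [dualPairing_apply]
  exact Finset.sum_congr rfl fun i _ => M.trace_pairing_smul he f (φ i) (ξ (x i)) y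

/-- If the cokernel of `Hom(Q, Aᵉ) → Hom(P, Aᵉ)` is isomorphic to `A` as a bimodule, then the
cokernel of `Hom(Q, End_k(M)) → Hom(P, End_k(M))` has the dimension of `End_A(M)`. -/
lemma finrank_range_add_finrank_end [Module.Finite (Env k A) P] [Module.Projective (Env k A) P]
    [Module.Finite (Env k A) Q] [Module.Projective (Env k A) Q] (i : P →ₗ[Env k A] Q)
    (hsurj : Function.Surjective e) (hker : ∀ ξ, e ξ = 0 ↔ ∃ ψ : Q →ₗ[Env k A] Env k A, ψ ∘ₗ i = ξ)
    (he : ∀ (a b : A) (ξ : P →ₗ[Env k A] Env k A),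
      e (LinearMap.toSpanSingleton (Env k A) (Env k A) (a ⊗ₜ MulOpposite.op b) ∘ₗ ξ) =
        b * e ξ * a) :
    Module.finrank k (LinearMap.range (precompHom k (Module.End k M.Mod) i)) +
        Module.finrank k (Module.End A M.Mod) =
      Module.finrank k (P →ₗ[Env k A] Module.End k M.Mod) := by
  obtain ⟨r, x, φ, hx⟩ := exists_finite_dualBasis (R := Env k A) P
  obtain ⟨t, z, χ, hz⟩ := exists_finite_dualBasis (R := Env k A) Q
  have hΨ := M.dualPairing_smulRightHom hx he
  obtain ⟨ξ₀, hξ₀⟩ := hsurj 1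
  have hinj : Function.Injective (M.dualPairing x φ e) :=
    (injective_iff_map_eq_zero _).2 fun f hf => by
      have h0 : LinearMap.restrictScalars k f = (0 : Module.End k M.Mod) :=
        eq_zero_of_trace_mul_eq_zero _ fun y => by
          have := hΨ f ξ₀ y
          rw [hf, hξ₀, map_one, mul_one] at this
          exact this.symm
      ext v
      exact LinearMap.congr_fun h0 v
  -- A functional vanishing on the image of `Hom(Q, E)` sees `ξ` only through its class `e ξ` in
  -- `A`.
  have hann : ∀ l ∈ (LinearMap.range (precompHom k (Module.End k M.Mod) i)).dualAnnihilator,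
      ∀ ξ ξ', e ξ = e ξ' → ∀ y, l (smulRightHom k ξ y) = l (smulRightHom k ξ' y) := by
    intro l hl ξ ξ' h y
    obtain ⟨ψ, hψ⟩ := (hker (ξ - ξ')).1 (by
      have hsub : ξ - ξ' + ξ' = ξ := by
        ext p
        exact sub_add_cancel (ξ p) (ξ' p)
      have hadd : e (ξ - ξ') + e ξ' = e ξ := (e.map_add _ _).symm.trans (congr_arg e hsub)
      rwa [h, add_eq_right] at hadd)
    have h1 : smulRightHom k ξ y - smulRightHom k ξ' y =
        precompHom k (Module.End k M.Mod) i (smulRightHom k ψ y) := by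
      rw [precompHom_smulRightHom, hψ]
      ext p : 1
      simp [sub_smul]
    rw [← sub_eq_zero, ← map_sub, h1]
    exact (Submodule.mem_dualAnnihilator l).1 hl _ ⟨_, rfl⟩
  have hrange : LinearMap.range (M.dualPairing x φ e) =
      (LinearMap.range (precompHom k (Module.End k M.Mod) i)).dualAnnihilator := by
    apply le_antisymm
    · rintro _ ⟨f, rfl⟩
      rw [Submodule.mem_dualAnnihilator]
      rintro _ ⟨H, rfl⟩
      rw [← sum_smulRightHom (k := k) hz H, map_sum, map_sum]
      refine Finset.sum_eq_zero fun j _ => ?_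
      rw [precompHom_smulRightHom, hΨ, (hker _).2 ⟨χ j, rfl⟩]
      simp
    · intro l hl
      -- `ξ₀` represents `1 : A`, which generates the cokernel, so `l` is determined by `y ↦ l(ξ₀ ⊗
      -- y)`, and the trace form represents this by some `g`.
      obtain ⟨g, hg⟩ := exists_trace_mul_eq (l ∘ₗ smulRightHom k ξ₀)
      have hg' : ∀ (s : Env k A) y, LinearMap.trace k M.Mod (g * (s • y)) =
          l (smulRightHom k (LinearMap.toSpanSingleton (Env k A) (Env k A) s ∘ₗ ξ₀) y) :=
        fun s y => by rw [hg, smulRightHom_rightMul]; rfl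
      -- `g` is `A`-linear because `a ⊗ 1` and `1 ⊗ a` both send the class of `ξ₀` to `a`.
      have hcomm : ∀ a, g * M.toEnd a = M.toEnd a * g := fun a => by
        rw [← sub_eq_zero]
        refine eq_zero_of_trace_mul_eq_zero _ fun y => ?_
        have h1 : LinearMap.trace k M.Mod (M.toEnd a * g * y) =
            LinearMap.trace k M.Mod (g * (y * M.toEnd a)) := by
          rw [mul_assoc, LinearMap.trace_mul_comm, mul_assoc]
        rw [sub_mul, map_sub, h1, mul_assoc, ← tmul_one_smul, ← one_tmul_smul, hg', hg',
          sub_eq_zero]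
        refine hann l hl _ _ ?_ y
        rw [he, he, hξ₀]
        simp
      let f : Module.End A M.Mod :=
        { toFun := g
          map_add' := map_add g
          map_smul' := fun a v => LinearMap.congr_fun (hcomm a) v }
      have hf : LinearMap.restrictScalars k f = g := rfl
      refine ⟨f, LinearMap.ext fun h => ?_⟩
      rw [← sum_smulRightHom (k := k) hx h, map_sum, map_sum]
      refine Finset.sum_congr rfl fun j _ => ?_
      rw [hΨ, hf, mul_assoc, ← tmul_one_smul, hg']
      refine hann l hl _ _ ?_ _
      rw [he, hξ₀, one_mul, one_mul]
  rw [← LinearMap.finrank_range_of_inj hinj, hrange]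
  exact Subspace.finrank_add_finrank_dualAnnihilator_eq _

end RepPt

end Duality

/-! ### The dimension of the tangent space -/

section Main

variable {k A : Type u} [Field k] [Ring A] [Algebra k A]

/-- A `2`-Calabi-Yau algebra has a resolution of length two by finitely generated projective
bimodules. -/
lemma IsCalabiYau.hasFGProjectiveResolution (hA : IsCalabiYau k A 2) :
    HasFGProjectiveResolution 2 (diagBimod k A) := by
  obtain ⟨P, hfin, m, hm⟩ := hA.smooth
  refine HasFGProjectiveResolution.of_shorten (fun i hi => hA.ext_eq_zero i (by lia)) m ?_
  rw [add_comm]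
  -- The vanishing bound is weakened to `m + 1` so that the length is at least two even when `m =
  -- 0`.
  exact hasFGProjectiveResolution_of_projectiveResolution P hfin (m + 1) fun i hi => hm i (by lia)

/-- The dimension of the tangent space of `Rep_A^n` at `M` exceeds that of `End_A(M)` by a locally
constant function. A resolution of length two by finitely generated projective bimodules computes
the difference, and the dimensions it contributes are locally constant automatically. -/
lemma exists_isLocallyConstant_finrank_tangentSpace [CharZero k] (n : ℕ)
    (hA : IsCalabiYau k A 2) :
    ∃ N : RepPt k A n → ℤ, IsLocallyConstant N ∧ ∀ M : RepPt k A n,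
      (Module.finrank k M.TangentSpace : ℤ) = N M + Module.finrank k (Module.End A M.Mod) := by
  obtain ⟨@⟨X₁, X₂, X₃, i, p, w⟩, hS, hX₃, hfin, hproj, @⟨P, Q, X₁', j, q, w'⟩, hT, hX₁,
    hfinQ, hprojQ, hfinP, hprojP⟩ := hA.hasFGProjectiveResolution
  dsimp only at hX₃ hfin hproj hX₁ hfinQ hprojQ hfinP hprojP
  subst hX₃ hX₁
  obtain ⟨ε, hε⟩ := hA.ext_iso
  have hP₂ : Projective X₂ := (IsProjective.iff_projective _).1 hproj
  have hPQ : Projective Q := (IsProjective.iff_projective _).1 hprojQ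
  obtain ⟨Θ, hΘ, hΘ₀, hΘg⟩ := exists_ext_two_presentation hS hT rfl (envBimod k A)
  -- The projection of `Hom(P, Aᵉ)` onto its quotient `Ext²(A, Aᵉ)`, followed by the Calabi-Yau
  -- isomorphism with `A`.
  let e : (P →ₗ[Env k A] Env k A) →+ A :=
    (ε.toAddMonoidHom.comp Θ).comp
      (ModuleCat.homAddEquiv (M := P) (N := envBimod k A)).symm.toAddMonoidHom
  have he : ∀ ξ, e ξ = ε (Θ (ModuleCat.ofHom ξ)) := fun _ => rfl
  have hq : Function.Surjective q.hom := hT.moduleCat_surjective_g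
  have hp : Function.Surjective p.hom := hS.moduleCat_surjective_g
  have hi : Function.Injective i.hom := hS.moduleCat_injective_f
  have hexT : Function.Exact j.hom q.hom :=
    (ShortComplex.ShortExact.moduleCat_exact_iff_function_exact _).1 hT.exact
  have hexS : Function.Exact i.hom p.hom :=
    (ShortComplex.ShortExact.moduleCat_exact_iff_function_exact _).1 hS.exact
  have hfin₁ : Module.Finite (Env k A) X₁' := Module.Finite.of_surjective q.hom hq
  have hloc := fun (Y : Type u) [AddCommGroup Y] [Module (Env k A) Y] [Module.Finite (Env k A) Y]
    [Module.Projective (Env k A) Y] =>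
      (isLocallyConstant_finrank_hom (n := n) (k := k) (A := A) Y).comp (Nat.cast : ℕ → ℤ)
  -- `Q` and `P` account for `Hom(X₁', E)` up to `End_A(M)`; `Aᵉ` and `X₂` are the Schanuel
  -- correction from `X₁'` to `Ω`.
  refine ⟨_, ((hloc Q).sub (hloc P)).add ((hloc (Env k A)).sub (hloc X₂)), fun M => ?_⟩
  have h₁ := finrank_hom_add_finrank_range (k := k) (N := Module.End k M.Mod) j.hom q.hom hexT hq
  have h₂ := M.finrank_range_add_finrank_end (e := e) j.hom
    (fun a => by
      obtain ⟨ξ, hξ⟩ := hΘ (ε.symm a)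
      exact ⟨ξ.hom, by rw [he, ModuleCat.ofHom_hom, hξ, ε.apply_symm_apply]⟩)
    (fun ξ => by
      rw [he, ε.map_eq_zero_iff, hΘ₀]
      constructor
      · rintro ⟨ψ, hψ⟩
        exact ⟨ψ.hom, congr_arg ModuleCat.Hom.hom hψ⟩
      · rintro ⟨ψ, rfl⟩
        exact ⟨ModuleCat.ofHom ψ, rfl⟩)
    (fun a b ξ => by
      rw [he, he, ← hε, ← hΘg]
      rfl)
  have h₃ := finrank_hom_schanuel (k := k) (N := Module.End k M.Mod) i.hom p.hom hi hexS hp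
    (envMul k A) envMul_surjective
  rw [M.finrank_tangentSpace]
  simp only [Pi.add_apply, Pi.sub_apply, Function.comp_apply]
  lia

end Main

end CYRep

end
theorem mainTheorem4 {k A : Type u} [Field k] [IsAlgClosed k] [CharZero k]
    [Ring A] [Algebra k A] [Algebra.FiniteType k A] (n : ℕ)
    (hA : CYRep.IsCalabiYau k A 2)
    (F : CategoryTheory.ProjectiveResolution (CYRep.diagBimod k A))
    (hF : ∀ i, Module.Finite (CYRep.Env k A) (F.complex.X i))
    (hc : ∀ i ≤ 2, IsLocallyConstant fun M : CYRep.RepPt k A n =>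
      Module.finrank k (F.complex.X i →ₗ[CYRep.Env k A] Module.End k M.Mod)) :
    (∃ N : CYRep.RepPt k A n → ℤ, IsLocallyConstant N ∧
      ∀ M : CYRep.RepPt k A n,
        (Module.finrank k M.TangentSpace : ℤ) = N M + Module.finrank k (Module.End A M.Mod)) ∧
    (∀ Z ∈ irreducibleComponents (CYRep.RepPt k A n), ∃ f : ℕ → ℤ, StrictMono f ∧
      ∀ M ∈ Z,
        (Module.finrank k M.TangentSpace : ℤ) = f (Module.finrank k (Module.End A M.Mod))) := by
  obtain ⟨N, hN, h⟩ := CYRep.exists_isLocallyConstant_finrank_tangentSpace n hA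
  refine ⟨⟨N, hN, h⟩, fun Z hZ => ?_⟩
  obtain ⟨M₀, hM₀⟩ := hZ.1.nonempty
  refine ⟨fun d => N M₀ + d, fun a b hab => by simpa using hab, fun M hM => ?_⟩
  -- An irreducible component is connected, so `N` is constant on it.
  rw [h M, hN.apply_eq_of_isPreconnected hZ.1.isPreirreducible.isPreconnected hM hM₀]
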